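/- Let $m\ge 1$, let $H_1,\dots,H_m$ be complex Hilbert spaces of finite dimensions $d_1,\dots,d_m\ge 1$, and let $d=d_1d_2\cdots d_m=\dim(H_1\otimes\cdots\otimes H_m)$. A density matrix is a positive semidefinite matrix of trace one, and a density matrix $\rho$ on $H_1\otimes\cdots\otimes H_m$ is separable if it is a finite mixture $\rho=\sum_s p_s\,\rho_s^1\otimes\cdots\otimes\rho_s^m$ with $p_s\ge 0$, $\sum_s p_s=1$ and each $\rho_s^k$ a density matrix on $H_k$. Let $\|A\|_2=(\operatorname{tr}AA^\dagger)^{1/2}$ be the Frobenius norm. (1) If $\rho$ is a density matrix on $H_1\otimes\cdots\otimes H_m$ and $$\Bigl\|\rho-\frac{I}{d}\Bigr\|_2\le\frac{1}{2^{m/2-1}\,d},$$ then $\rho$ is separable. (2) Let $\pi=|\psi\rangle\langle\psi|$ be a pure state, with $\psi\in H_1\otimes\cdots\otimes H_m$ a unit vector, and let $\varepsilon\ge 0$. If $$\varepsilon\le\frac{2^{-(m/2-1)}}{\sqrt{d(d-1)}}$$ (that is, $\varepsilon\sqrt{d(d-1)}\le 2^{-(m/2-1)}$, which is no restriction when $d=1$),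 then the pseudopure state $\varepsilon\,\pi+(1-\varepsilon)I/d$ is separable. -/

import Mathlib

open scoped ComplexOrder

-- The norm `‖A‖` of a matrix is the Frobenius norm `√(∑ i j, ‖A i j‖ ^ 2) = √(tr (A Aᴴ))`.
attribute [local instance] Matrix.frobeniusNormedAddCommGroup

/-- A (normalized) density matrix: positive semidefinite with unit trace. -/
def IsDensityMatrix {ι : Type*} [Fintype ι] (ρ : Matrix ι ι ℂ) : Prop :=
  ρ.PosSemidef ∧ ρ.trace = 1

/-- Basis labels `(i₁, …, iₘ)` of `ℂ^{d₁} ⊗ ⋯ ⊗ ℂ^{dₘ}`. -/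
abbrev MultiIndex {m : ℕ} (d : Fin m → ℕ) : Type :=
  (k : Fin m) → Fin (d k)

/-- The tensor product `A₁ ⊗ ⋯ ⊗ Aₘ`, a matrix on `ℂ^{d₁} ⊗ ⋯ ⊗ ℂ^{dₘ}`. -/
def tensorMatrix {m : ℕ} {d : Fin m → ℕ}
    (A : (k : Fin m) → Matrix (Fin (d k)) (Fin (d k)) ℂ) :
    Matrix (MultiIndex d) (MultiIndex d) ℂ :=
  Matrix.of fun i j => ∏ k, A k (i k) (j k)

/-- Separability: `ρ` is a finite mixture `∑ₛ pₛ ρₛ¹ ⊗ ⋯ ⊗ ρₛᵐ` of product states. -/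
def IsSeparableState {m : ℕ} {d : Fin m → ℕ}
    (ρ : Matrix (MultiIndex d) (MultiIndex d) ℂ) : Prop :=
  ∃ (N : ℕ) (p : Fin N → ℝ)
    (σ : Fin N → (k : Fin m) → Matrix (Fin (d k)) (Fin (d k)) ℂ),
    (∀ s, 0 ≤ p s) ∧ ∑ s, p s = 1 ∧ (∀ s k, IsDensityMatrix (σ s k)) ∧
      ρ = ∑ s, (p s : ℂ) • tensorMatrix (σ s)

/-- The total dimension `d₁ d₂ ⋯ dₘ`. -/
def totalDim {m : ℕ} (d : Fin m → ℕ) : ℕ := ∏ k, d k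

/-- The maximally mixed state `I / (d₁ ⋯ dₘ)`. -/
noncomputable def maxMixed {m : ℕ} (d : Fin m → ℕ) :
    Matrix (MultiIndex d) (MultiIndex d) ℂ :=
  ((totalDim d : ℂ)⁻¹) • (1 : Matrix (MultiIndex d) (MultiIndex d) ℂ)

/-- The rank-one projection `|ψ⟩⟨ψ|`; a pure state when `ψ` is a unit vector. -/
def pureProj {ι : Type*} (ψ : EuclideanSpace ℂ ι) : Matrix ι ι ℂ :=
  Matrix.vecMulVec (fun i => ψ i) (fun i => star (ψ i))

/-- The pseudopure state `ε |ψ⟩⟨ψ| + (1 - ε) I / (d₁ ⋯ dₘ)`. -/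
noncomputable def pseudopure {m : ℕ} (d : Fin m → ℕ) (ε : ℝ)
    (ψ : EuclideanSpace ℂ (MultiIndex d)) : Matrix (MultiIndex d) (MultiIndex d) ℂ :=
  (ε : ℂ) • pureProj ψ + ((1 - ε : ℝ) : ℂ) • maxMixed d

/-!
The proof dualizes. The separable states form the convex hull of a compact set, so an inseparable
density matrix `ρ` is detected by a Hermitian matrix `W` which is nonnegative on product vectors
(`IsBlockPositive`) and has `tr (W ρ) < 0` (`exists_isBlockPositive_re_trace_mul_neg`). By
Cauchy–Schwarz, no state in the ball of the theorem can be detected by `W` as soon as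
`‖W‖ ≤ √2 ^ (m - 2) * tr W`. This is `IsBlockPositive.frobenius_norm_le`, for `m ≥ 2`; with
at most one factor every state is separable.

The norm bound is proved by induction on `m`. Write `W` as a matrix of blocks `W i j` acting on all
factors but the first. Compressing by the vector `eᵢ + z eⱼ` of the first factor shows that
`W i i + |z|² W j j + z W i j + z̄ (W i j)ᴴ` is again nonnegative on product vectors, for every
complex `z`. From this one gets `‖W i j‖² ≤ K tr (W i i) tr (W j j)`, and summing over `i, j` gives
`‖W‖² ≤ K (tr W)²`.

* For `m = 2` the compressions are positive semidefinite and `K = 1`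
  (`frobenius_norm_sq_le_of_compressTwo_posSemidef`). This is the Russo–Dye phenomenon: for a unitary
  `U` with spectral projections `Q`, positivity bounds each `tr (W i j Q)`, hence
  `|tr (W i j U)| ≤ √(tr (W i i) tr (W j j))`, and the supremum of the left-hand side over `U` is the
  trace norm of `W i j`, which dominates the Frobenius norm.
* In the induction step only the norm bound for the compressions is available; comparing `z` with
  `-z` bounds `z W i j + z̄ (W i j)ᴴ`, and combining `z = t` with `z = t i` bounds `W i j` at the cost
  of a factor `2` in `K` (`frobenius_norm_sq_le_of_compressTwo_norm_le`).

The statement on pseudopure states follows, their distance to the maximally mixed state being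
`ε √(1 - 1 / d)`.
-/

open Matrix

attribute [local instance] Matrix.frobeniusNormedSpace

/-! ### Frobenius norm and unitary matrices -/

theorem frobenius_norm_sq {m n : Type*} [Fintype m] [Fintype n] (A : Matrix m n ℂ) :
    ‖A‖ ^ 2 = ∑ i, ∑ j, ‖A i j‖ ^ 2 := by
  rw [Matrix.frobenius_norm_def, ← Real.sqrt_eq_rpow, Real.sq_sqrt (by positivity)]
  simp

theorem re_trace_mul_conjTranspose_self {m n : Type*} [Fintype m] [Fintype n]
    (A : Matrix m n ℂ) : (A * Aᴴ).trace.re = ‖A‖ ^ 2 := by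
  rw [frobenius_norm_sq]
  simp [Matrix.trace, Matrix.mul_apply, Complex.mul_conj, Complex.normSq_eq_norm_sq]
  norm_cast

/-- Cauchy–Schwarz for the Frobenius inner product. -/
theorem abs_re_trace_mul_conjTranspose_le {m n : Type*} [Fintype m] [Fintype n]
    (A B : Matrix m n ℂ) : |(A * Bᴴ).trace.re| ≤ ‖A‖ * ‖B‖ := by
  have key (t : ℝ) : 0 ≤ ‖B‖ ^ 2 * (t * t) + 2 * (A * Bᴴ).trace.re * t + ‖A‖ ^ 2 := by
    have h := re_trace_mul_conjTranspose_self (A + (t : ℂ) • B)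
    have hBA : (B * Aᴴ).trace.re = (A * Bᴴ).trace.re := by
      rw [← Matrix.conjTranspose_conjTranspose (B * Aᴴ), Matrix.trace_conjTranspose]
      simp
    simp only [Matrix.conjTranspose_add, Matrix.conjTranspose_smul, Matrix.add_mul, Matrix.mul_add,
      Matrix.smul_mul, Matrix.mul_smul, Matrix.trace_add, Matrix.trace_smul, Complex.add_re,
      smul_eq_mul, Complex.star_def, Complex.conj_ofReal, Complex.re_ofReal_mul, hBA,
      re_trace_mul_conjTranspose_self] at h
    nlinarith [sq_nonneg ‖A + (t : ℂ) • B‖]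
  have h := discrim_le_zero key
  rw [discrim] at h
  apply abs_le_of_sq_le_sq _ (by positivity)
  nlinarith

/-- If a `2 × 2` Hermitian form is nonnegative on all vectors `(1, z)`, then its determinant is
nonnegative. -/
theorem norm_sq_le_mul_of_forall_nonneg {a b : ℝ} {c : ℂ}
    (h : ∀ z : ℂ, 0 ≤ a + Complex.normSq z * b + 2 * (z * c).re) : ‖c‖ ^ 2 ≤ a * b := by
  by_cases hc : c = 0
  · have ha : 0 ≤ a := by simpa using h 0
    have key (t : ℝ) : 0 ≤ b * (t * t) + 0 * t + a := by
      have := h t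
      simp [hc] at this
      linarith
    have := discrim_le_zero key
    simp [discrim] at this
    simp [hc]
    linarith
  have hn : ‖c‖ ≠ 0 := by simpa using hc
  have key (t : ℝ) : 0 ≤ b * (t * t) + (2 * ‖c‖) * t + a := by
    -- the phase of `z` is opposite to that of `c`
    have := h (t * (star c / ‖c‖))
    have h1 : (t * (star c / ‖c‖)) * c = ((t * ‖c‖ : ℝ) : ℂ) := by
      have : star c * c = (‖c‖ : ℂ) ^ 2 := by
        rw [mul_comm]; simp [Complex.mul_conj, Complex.normSq_eq_norm_sq]
      have hn' : (‖c‖ : ℂ) ≠ 0 := by exact_mod_cast hn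
      field_simp
      rw [mul_assoc, this]; push_cast; ring
    have h2 : Complex.normSq (t * (star c / ‖c‖)) = t * t := by
      simp [Complex.normSq_eq_norm_sq, hn]
      ring
    rw [h1, h2, Complex.ofReal_re] at this
    linarith
  have := discrim_le_zero key
  rw [discrim] at this
  nlinarith

theorem Matrix.PosSemidef.trace_mul_conjTranspose_mul_self_nonneg {n : Type*} [Fintype n]
    {A : Matrix n n ℂ} (hA : A.PosSemidef) (Q : Matrix n n ℂ) : 0 ≤ (A * (Qᴴ * Q)).trace := by
  rw [← Matrix.mul_assoc, Matrix.trace_mul_comm, ← Matrix.mul_assoc]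
  exact (hA.mul_mul_conjTranspose_same Q).trace_nonneg

/-- The spectral resolution of a unitary matrix: it is a combination with unimodular coefficients
of orthogonal projections (hence of matrices `Qᴴ * Q = Q`) adding up to the identity. -/
theorem exists_resolution_of_mem_unitaryGroup {n : Type*} [Fintype n] [DecidableEq n]
    {U : Matrix n n ℂ} (hU : U ∈ Matrix.unitaryGroup n ℂ) :
    ∃ (s : Finset ℂ) (Q : ℂ → Matrix n n ℂ), (∀ l ∈ s, ‖l‖ = 1) ∧ (∀ l, (Q l)ᴴ * Q l = Q l) ∧
      ∑ l ∈ s, Q l = 1 ∧ ∑ l ∈ s, l • Q l = U := by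
  let Φ := Matrix.toEuclideanCLM (n := n) (𝕜 := ℂ)
  let V := Φ U
  have hV : V ∈ unitary (EuclideanSpace ℂ n →L[ℂ] EuclideanSpace ℂ n) :=
    Unitary.map_mem Φ hU
  have hnorm : IsStarNormal V := ⟨(hV.1.trans hV.2.symm)⟩
  have hfin : (spectrum ℂ V).Finite := by
    have : spectrum ℂ V = spectrum ℂ U := AlgEquiv.spectrum_eq Φ U
    rw [this]
    exact Matrix.finite_spectrum U
  -- every function is continuous on a finite spectrum, in particular the indicator of a point
  have hcont (f : ℂ → ℂ) : ContinuousOn f (spectrum ℂ V) := hfin.continuousOn f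
  let e (l : ℂ) : ℂ → ℂ := fun x => if x = l then 1 else 0
  refine ⟨hfin.toFinset, fun l => Φ.symm (cfc (e l) V), fun l hl => ?_, fun l => ?_, ?_, ?_⟩
  · exact spectrum.norm_eq_one_of_unitary hV (hfin.mem_toFinset.1 hl)
  · have hstar : (Φ.symm (cfc (e l) V))ᴴ = Φ.symm (star (cfc (e l) V)) :=
      (map_star Φ.symm _).symm
    rw [hstar, ← map_mul, ← cfc_star, ← cfc_mul _ _ _ (hcont _) (hcont _)]
    congr 2
    ext x
    by_cases hx : x = l <;> simp [e, hx]
  · rw [← map_sum, ← cfc_sum _ _ _ (fun _ _ => hcont _), ← map_one Φ.symm, ← cfc_const_one ℂ V]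
    congr 1
    refine cfc_congr fun x hx => ?_
    simpa [e] using hx
  · have h1 (l : ℂ) : l • Φ.symm (cfc (e l) V) = Φ.symm (cfc (fun x => l * e l x) V) := by
      rw [cfc_const_mul _ _ _ (hcont _), map_smul]
    simp_rw [h1]
    rw [← map_sum, ← cfc_sum _ _ _ (fun _ _ => hcont _)]
    have h2 : cfc (∑ l ∈ hfin.toFinset, fun x => l * e l x) V = V := by
      conv_rhs => rw [← cfc_id ℂ V]
      refine cfc_congr fun x hx => ?_
      simp only [Finset.sum_apply, e]
      simpa using fun h => absurd hx h
    rw [h2]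
    exact Φ.symm_apply_apply U

/-- For a positive semidefinite matrix the Frobenius norm is at most the trace. -/
theorem Matrix.PosSemidef.frobenius_norm_le_trace {n : Type*} [Fintype n] {A : Matrix n n ℂ}
    (hA : A.PosSemidef) : ‖A‖ ≤ A.trace.re := by
  classical
  have hent (i j : n) : ‖A i j‖ ^ 2 ≤ (A i i).re * (A j j).re := by
    apply norm_sq_le_mul_of_forall_nonneg
    intro z
    have h := (Complex.le_def.1 (hA.dotProduct_mulVec_nonneg (Pi.single i 1 + z • Pi.single j 1))).1
    have hji : A j i = star (A i j) := (hA.1.apply j i).symm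
    simp [Matrix.mulVec_add, Matrix.mulVec_smul, add_dotProduct, hji, Complex.normSq_apply] at h ⊢
    linarith
  have hnn : 0 ≤ A.trace.re := (Complex.le_def.1 hA.trace_nonneg).1
  apply le_of_sq_le_sq _ hnn
  rw [frobenius_norm_sq, Matrix.trace, Complex.re_sum, sq, Finset.sum_mul_sum]
  exact Finset.sum_le_sum fun i _ => Finset.sum_le_sum fun j _ => hent i j

/-- Over `ℂ`, Hermitian symmetry follows from the positivity of the quadratic form. -/
theorem posSemidef_of_forall_dotProduct_mulVec_nonneg {n : Type*} [Fintype n]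
    {T : Matrix n n ℂ} (h : ∀ v, 0 ≤ star v ⬝ᵥ T *ᵥ v) : T.PosSemidef := by
  classical
  rw [← Matrix.isPositive_toEuclideanLin_iff, LinearMap.isPositive_iff_complex]
  intro v
  have hv := Complex.le_def.1 (h v.ofLp)
  have hin : inner ℂ (T.toEuclideanLin v) v = star (star v.ofLp ⬝ᵥ T *ᵥ v.ofLp) := by
    rw [EuclideanSpace.inner_eq_star_dotProduct, dotProduct_comm (star v.ofLp)]
    exact Matrix.dotProduct_star _ _
  rw [hin]
  refine ⟨?_, by simpa using hv.1⟩
  apply Complex.ext <;> simp [← hv.2]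

/-- Rotating the phase of the vector `v` is a unitary operation. -/
theorem one_add_smul_vecMulVec_mem_unitaryGroup {n : Type*} [Fintype n] [DecidableEq n]
    {v : n → ℂ} (hv : v ≠ 0) {w : ℂ} (hw : ‖w‖ = 1) :
    1 + ((w - 1) / (star v ⬝ᵥ v)) • Matrix.vecMulVec v (star v) ∈ Matrix.unitaryGroup n ℂ := by
  have hN : star v ⬝ᵥ v ≠ 0 := by simpa using hv
  have hNr : star (star v ⬝ᵥ v) = star v ⬝ᵥ v := (Matrix.star_dotProduct v v).symm
  have hww : w * star w = 1 := by
    simp [Complex.mul_conj, Complex.normSq_eq_norm_sq, hw]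
  rw [Matrix.mem_unitaryGroup_iff, Matrix.star_eq_conjTranspose]
  simp only [Matrix.conjTranspose_add, Matrix.conjTranspose_one, Matrix.conjTranspose_smul,
    Matrix.conjTranspose_vecMulVec, star_star, Matrix.add_mul, Matrix.mul_add, Matrix.one_mul,
    Matrix.mul_one, Matrix.smul_mul, Matrix.mul_smul, Matrix.vecMulVec_mul_vecMulVec, smul_smul,
    star_div₀, hNr, star_sub, star_one, Matrix.vecMulVec_smul]
  match_scalars
  · ring
  · field_simp
    linear_combination hww

/-- The unitary group is closed, with entries in the unit disc. -/
theorem isCompact_unitaryGroup {n : Type*} [Fintype n] [DecidableEq n] :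
    IsCompact {U : n → n → ℂ | Matrix.of U ∈ Matrix.unitaryGroup n ℂ} := by
  refine IsCompact.of_isClosed_subset (isCompact_univ_pi fun _ : n => isCompact_univ_pi
    fun _ : n => isCompact_closedBall (0 : ℂ) 1) ?_ ?_
  · have : {U : n → n → ℂ | Matrix.of U ∈ Matrix.unitaryGroup n ℂ} =
        ⋂ (i : n) (j : n), {U | ∑ k, U i k * star (U j k) = (1 : Matrix n n ℂ) i j} := by
      ext U
      simp only [Set.mem_iInter, Set.mem_ofPred_eq]
      rw [Matrix.mem_unitaryGroup_iff, ← Matrix.ext_iff]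
      rfl
    rw [this]
    exact isClosed_iInter fun i => isClosed_iInter fun j =>
      isClosed_eq (by fun_prop) continuous_const
  · intro U hU i _ j _
    simpa using entry_norm_bound_of_unitary hU i j

theorem exists_unitary_forall_re_trace_le {n : Type*} [Fintype n] [DecidableEq n]
    (C : Matrix n n ℂ) : ∃ U ∈ Matrix.unitaryGroup n ℂ,
      ∀ V ∈ Matrix.unitaryGroup n ℂ, (C * V).trace.re ≤ (C * U).trace.re := by
  have htr (V : n → n → ℂ) : (∑ i, ∑ k, C i k * V k i) = (C * Matrix.of V).trace := by
    simp [Matrix.trace, Matrix.mul_apply]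
  obtain ⟨U, hU, hmax⟩ := (isCompact_unitaryGroup (n := n)).exists_isMaxOn
    ⟨Matrix.of.symm 1, one_mem (Matrix.unitaryGroup n ℂ)⟩
    (f := fun U : n → n → ℂ => (∑ i, ∑ k, C i k * U k i).re) (by fun_prop)
  refine ⟨Matrix.of U, hU, fun V hV => ?_⟩
  have := hmax (show Matrix.of.symm V ∈ _ from hV)
  simpa only [Set.mem_ofPred_eq, htr, Equiv.apply_symm_apply] using this

/-- The Frobenius norm is dominated by the trace norm, in its variational form. The proof takes a
unitary `U` maximizing `Re tr (C U)`; then `C U` is positive semidefinite. -/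
theorem frobenius_norm_le_of_forall_unitary {n : Type*} [Fintype n] [DecidableEq n]
    {C : Matrix n n ℂ} {K : ℝ} (h : ∀ U ∈ Matrix.unitaryGroup n ℂ, (C * U).trace.re ≤ K) :
    ‖C‖ ≤ K := by
  obtain ⟨U, hU, hmax⟩ := exists_unitary_forall_re_trace_le C
  have hpos : (C * U).PosSemidef := by
    apply posSemidef_of_forall_dotProduct_mulVec_nonneg
    intro v
    by_cases hv : v = 0
    · simp [hv]
    set t := star v ⬝ᵥ (C * U) *ᵥ v with ht
    by_cases ht0 : t = 0
    · rw [ht0]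
    have htn : (‖t‖ : ℂ) ≠ 0 := by simpa using ht0
    have hN : 0 < star v ⬝ᵥ v := by simpa using hv
    have hNr : star v ⬝ᵥ v = ((star v ⬝ᵥ v).re : ℂ) :=
      Complex.ext rfl (by simpa using (Complex.lt_def.1 hN).2.symm)
    have hNp : 0 < (star v ⬝ᵥ v).re := (Complex.lt_def.1 hN).1
    -- rotate `v` by the phase that makes `t` positive
    have hw : ‖star t / (‖t‖ : ℂ)‖ = 1 := by simp [ht0]
    have h1 := hmax _ (mul_mem hU (one_add_smul_vecMulVec_mem_unitaryGroup hv hw))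
    have htt : star t * t = (‖t‖ : ℂ) ^ 2 := by
      rw [mul_comm]; simp [Complex.mul_conj, Complex.normSq_eq_norm_sq]
    rw [← Matrix.mul_assoc, Matrix.mul_add, Matrix.mul_one, Matrix.trace_add, Complex.add_re,
      Matrix.mul_smul, Matrix.trace_smul, Matrix.mul_vecMulVec, Matrix.trace_vecMulVec,
      dotProduct_comm _ (star v), ← ht, hNr] at h1
    have h2 : ((star t / (‖t‖ : ℂ) - 1) / ((star v ⬝ᵥ v).re : ℂ)) • t =
        (((star v ⬝ᵥ v).re)⁻¹ : ℝ) * (‖t‖ - t) := by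
      push_cast
      simp only [smul_eq_mul]
      field_simp
      linear_combination htt
    rw [h2, Complex.re_ofReal_mul] at h1
    have h3 : ‖t‖ ≤ t.re := by
      have : (star v ⬝ᵥ v).re⁻¹ * (‖t‖ - t.re) ≤ 0 := by simpa using h1
      have := nonpos_of_mul_nonpos_right this (by positivity)
      linarith
    exact Complex.nonneg_iff.2 ⟨(norm_nonneg t).trans h3,
      ((Complex.abs_re_eq_norm.1 (le_antisymm (Complex.abs_re_le_norm t)
        (h3.trans (le_abs_self _)))).symm)⟩
  have hnorm : ‖C * U‖ = ‖C‖ := by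
    have hUU : U * Uᴴ = 1 := Matrix.mem_unitaryGroup_iff.1 hU
    rw [← sq_eq_sq₀ (norm_nonneg _) (norm_nonneg _), ← re_trace_mul_conjTranspose_self,
      ← re_trace_mul_conjTranspose_self, Matrix.conjTranspose_mul, Matrix.mul_assoc,
      ← Matrix.mul_assoc _ _ Cᴴ, hUU, Matrix.one_mul]
  rw [← hnorm]
  exact hpos.frobenius_norm_le_trace.trans (h U hU)

/-! ### Norm estimates for an off-diagonal block -/

/-- The compression of the Hermitian block matrix `[[A, C], [Cᴴ, B]]` by the vector `(1, z)`. -/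
def compressTwo {n : Type*} (A B C : Matrix n n ℂ) (z : ℂ) : Matrix n n ℂ :=
  A + (Complex.normSq z : ℂ) • B + z • C + star z • Cᴴ

theorem re_trace_compressTwo_mul {n : Type*} [Fintype n] (A B C P : Matrix n n ℂ)
    (hP : P.IsHermitian) (z : ℂ) :
    (compressTwo A B C z * P).trace.re = (A * P).trace.re +
      Complex.normSq z * (B * P).trace.re + 2 * (z * (C * P).trace).re := by
  have h : (Cᴴ * P).trace = star (C * P).trace := by
    rw [← Matrix.trace_conjTranspose, Matrix.conjTranspose_mul, hP.eq, Matrix.trace_mul_comm]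
  simp only [compressTwo, Matrix.add_mul, Matrix.smul_mul, Matrix.trace_add, Matrix.trace_smul, h,
    smul_eq_mul, Complex.add_re, Complex.re_ofReal_mul]
  simp
  ring

/-- The block estimate behind the sharp bipartite radius. By Russo–Dye, it suffices to bound
`tr (C U)` for unitary `U`; there positivity is applied to each spectral projection of `U`. -/
theorem frobenius_norm_sq_le_of_compressTwo_posSemidef {n : Type*} [Fintype n]
    {A B C : Matrix n n ℂ} (h : ∀ z, (compressTwo A B C z).PosSemidef) :
    ‖C‖ ^ 2 ≤ A.trace.re * B.trace.re := by
  classical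
  have hform {Q : Matrix n n ℂ} (hQ : Qᴴ * Q = Q) (z : ℂ) :
      0 ≤ (A * Q).trace.re + Complex.normSq z * (B * Q).trace.re + 2 * (z * (C * Q).trace).re := by
    have hQh : Q.IsHermitian := by
      rw [← hQ]; exact Matrix.isHermitian_conjTranspose_mul_self Q
    rw [← re_trace_compressTwo_mul A B C Q hQh]
    have := (h z).trace_mul_conjTranspose_mul_self_nonneg Q
    rw [hQ] at this
    exact (Complex.le_def.1 this).1
  have hA {Q : Matrix n n ℂ} (hQ : Qᴴ * Q = Q) : 0 ≤ (A * Q).trace.re := by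
    simpa using hform hQ 0
  have hB {Q : Matrix n n ℂ} (hQ : Qᴴ * Q = Q) : 0 ≤ (B * Q).trace.re := by
    have key (t : ℝ) : 0 ≤ (B * Q).trace.re * (t * t) + 0 * t + (A * Q).trace.re := by
      have h1 := hform hQ t
      have h2 := hform hQ (-t : ℝ)
      simp at h1 h2
      linarith
    -- a negative coefficient of `t²` is refuted by a large `t`
    by_contra hneg
    push Not at hneg
    have h1 := key (((A * Q).trace.re + 1) / (-(B * Q).trace.re) + 1)
    set a := (A * Q).trace.re
    set b := -(B * Q).trace.re
    have ha : 0 ≤ a := hA hQ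
    have hb : 0 < b := by simp only [b]; linarith
    have h2 : b * ((a + 1) / b) = a + 1 := by field_simp
    have h3 : 0 < (a + 1) / b := by positivity
    have hbb : (B * Q).trace.re = -b := by simp [b]
    rw [hbb] at h1
    nlinarith
  have hone : (1 : Matrix n n ℂ)ᴴ * 1 = 1 := by simp
  have ha := hA hone
  have hb := hB hone
  rw [Matrix.mul_one] at ha hb
  have hK : ‖C‖ ≤ √A.trace.re * √B.trace.re := by
    apply frobenius_norm_le_of_forall_unitary
    intro U hU
    obtain ⟨s, Q, hs, hQ, hsum, hUQ⟩ := exists_resolution_of_mem_unitaryGroup hU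
    have hQle (l : ℂ) : ‖(C * Q l).trace‖ ≤ √(A * Q l).trace.re * √(B * Q l).trace.re := by
      rw [← Real.sqrt_mul (hA (hQ l))]
      exact Real.le_sqrt_of_sq_le (norm_sq_le_mul_of_forall_nonneg (hform (hQ l)))
    have hsumtr (X : Matrix n n ℂ) : ∑ l ∈ s, (X * Q l).trace.re = X.trace.re := by
      rw [← Complex.re_sum, ← Matrix.trace_sum, ← Matrix.mul_sum, hsum, Matrix.mul_one]
    calc (C * U).trace.re ≤ ‖(C * U).trace‖ := Complex.re_le_norm _
      _ = ‖∑ l ∈ s, l * (C * Q l).trace‖ := by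
        rw [← hUQ, Matrix.mul_sum, Matrix.trace_sum]
        simp
      _ ≤ ∑ l ∈ s, ‖(C * Q l).trace‖ :=
        norm_sum_le_of_le _ fun l hl => by rw [norm_mul, hs l hl, one_mul]
      _ ≤ ∑ l ∈ s, √(A * Q l).trace.re * √(B * Q l).trace.re :=
        Finset.sum_le_sum fun l _ => hQle l
      _ ≤ √(∑ l ∈ s, (A * Q l).trace.re) * √(∑ l ∈ s, (B * Q l).trace.re) :=
        Real.sum_sqrt_mul_sqrt_le s (fun l => hA (hQ l)) (fun l => hB (hQ l))
      _ = √A.trace.re * √B.trace.re := by rw [hsumtr, hsumtr]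
  calc ‖C‖ ^ 2 ≤ (√A.trace.re * √B.trace.re) ^ 2 := by gcongr
    _ = A.trace.re * B.trace.re := by rw [mul_pow, Real.sq_sqrt ha, Real.sq_sqrt hb]

theorem frobenius_parallelogram {m n : Type*} [Fintype m] [Fintype n] (A B : Matrix m n ℂ) :
    ‖A + B‖ ^ 2 + ‖A - B‖ ^ 2 = 2 * ‖A‖ ^ 2 + 2 * ‖B‖ ^ 2 := by
  simp only [frobenius_norm_sq, ← Finset.sum_add_distrib, Finset.mul_sum]
  refine Finset.sum_congr rfl fun i _ => Finset.sum_congr rfl fun j _ => ?_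
  have := parallelogram_law_with_norm ℝ (A i j) (B i j)
  simp only [Matrix.add_apply, Matrix.sub_apply]
  linarith

/-- The block estimate of the induction step. Positivity on all of the four phases `±1`, `±i` only
controls the Hermitian and skew-Hermitian parts of `C`, whence the additional factor `2`. -/
theorem frobenius_norm_sq_le_of_compressTwo_norm_le {n : Type*} [Fintype n]
    {A B C : Matrix n n ℂ} {c : ℝ}
    (h : ∀ z, ‖compressTwo A B C z‖ ≤ c * (compressTwo A B C z).trace.re) :
    ‖C‖ ^ 2 ≤ 2 * c ^ 2 * (A.trace.re * B.trace.re) := by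
  classical
  have htr (z : ℂ) : (compressTwo A B C z).trace.re =
      A.trace.re + Complex.normSq z * B.trace.re + 2 * (z * C.trace).re := by
    simpa using re_trace_compressTwo_mul A B C 1 Matrix.isHermitian_one z
  have hz (z : ℂ) : ‖z • C + star z • Cᴴ‖ ≤ c * (A.trace.re + Complex.normSq z * B.trace.re) := by
    have h1 := h z
    have h2 := h (-z)
    rw [htr] at h1 h2
    have h3 : (2 : ℝ) • (z • C + star z • Cᴴ) = compressTwo A B C z - compressTwo A B C (-z) := by
      simp only [compressTwo, Complex.normSq_neg, star_neg, neg_smul, two_smul]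
      abel
    have h4 := norm_sub_le (compressTwo A B C z) (compressTwo A B C (-z))
    rw [← h3, norm_smul, Real.norm_ofNat] at h4
    rw [Complex.normSq_neg, neg_mul, Complex.neg_re] at h2
    nlinarith
  -- the phases `1` and `i` give the Hermitian and skew-Hermitian parts of `C`
  have key (t : ℝ) : √2 * t * ‖C‖ ≤ c * (A.trace.re + t * t * B.trace.re) := by
    have h1 := hz t
    have h2 := hz (t * Complex.I)
    have e1 : ‖(t : ℂ) • C + star (t : ℂ) • Cᴴ‖ = |t| * ‖C + Cᴴ‖ := by
      rw [← Real.norm_eq_abs, ← Complex.norm_real, ← norm_smul, smul_add]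
      simp
    have e2 : ‖(t * Complex.I) • C + star (t * Complex.I) • Cᴴ‖ = |t| * ‖C - Cᴴ‖ := by
      have : (t * Complex.I) • C + star (t * Complex.I) • Cᴴ = (t * Complex.I) • (C - Cᴴ) := by
        simp [sub_eq_add_neg]
      rw [this, norm_smul]
      simp
    have h3 := frobenius_parallelogram C Cᴴ
    rw [Matrix.frobenius_norm_conjTranspose] at h3
    rw [e1] at h1
    rw [e2] at h2
    simp only [Complex.normSq_ofReal, Complex.normSq_mul, Complex.normSq_I, mul_one] at h1 h2
    have h0 : 0 ≤ c * (A.trace.re + t * t * B.trace.re) := le_trans (by positivity) h1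
    apply le_of_sq_le_sq _ h0
    have h1' := pow_le_pow_left₀ (by positivity) h1 2
    have h2' := pow_le_pow_left₀ (by positivity) h2 2
    rw [mul_pow, sq_abs] at h1' h2'
    have hs2 : √2 ^ 2 = 2 := Real.sq_sqrt (by norm_num)
    rw [mul_pow, mul_pow, hs2]
    nlinarith
  have hd := discrim_le_zero (a := c * B.trace.re) (b := -(√2 * ‖C‖)) (c := c * A.trace.re)
    fun t => by nlinarith [key t]
  rw [discrim, neg_sq, mul_pow, Real.sq_sqrt (by norm_num)] at hd
  nlinarith

/-! ### Block-positive matrices -/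

/-- The product vector `x₁ ⊗ ⋯ ⊗ xₘ`. -/
def prodVec {m : ℕ} {d : Fin m → ℕ} (x : (k : Fin m) → Fin (d k) → ℂ) : MultiIndex d → ℂ :=
  fun i => ∏ k, x k (i k)

/-- A Hermitian matrix whose quadratic form is nonnegative on product vectors, i.e. an element of
the dual of the cone generated by the separable states. Only the real part of the form is
constrained, as its imaginary part vanishes. -/
def IsBlockPositive {m : ℕ} {d : Fin m → ℕ} (W : Matrix (MultiIndex d) (MultiIndex d) ℂ) : Prop :=
  W.IsHermitian ∧ ∀ x : (k : Fin m) → Fin (d k) → ℂ,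
    0 ≤ (star (prodVec x) ⬝ᵥ W *ᵥ prodVec x).re

/-- The `(i, j)` block of `W` with respect to the first tensor factor. -/
def headBlock {m : ℕ} {d : Fin (m + 1) → ℕ} (W : Matrix (MultiIndex d) (MultiIndex d) ℂ)
    (i j : Fin (d 0)) :
    Matrix (MultiIndex fun k : Fin m => d k.succ) (MultiIndex fun k : Fin m => d k.succ) ℂ :=
  Matrix.of fun p q => W (Fin.cons i p) (Fin.cons j q)

/-- The compression of `W` by the vector `x` in the first tensor factor. -/
def headCompress {m : ℕ} {d : Fin (m + 1) → ℕ} (W : Matrix (MultiIndex d) (MultiIndex d) ℂ)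
    (x : Fin (d 0) → ℂ) :
    Matrix (MultiIndex fun k : Fin m => d k.succ) (MultiIndex fun k : Fin m => d k.succ) ℂ :=
  ∑ i, ∑ j, (star (x i) * x j) • headBlock W i j

theorem sum_multiIndex_succ {m : ℕ} {d : Fin (m + 1) → ℕ} {M : Type*} [AddCommMonoid M]
    (f : MultiIndex d → M) :
    ∑ i, f i = ∑ a : Fin (d 0), ∑ p : MultiIndex fun k : Fin m => d k.succ, f (Fin.cons a p) := by
  rw [← (Fin.consEquiv fun k => Fin (d k)).sum_comp, Fintype.sum_prod_type]
  rfl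

theorem prodVec_cons {m : ℕ} {d : Fin (m + 1) → ℕ} (x : (k : Fin (m + 1)) → Fin (d k) → ℂ)
    (a : Fin (d 0)) (p : MultiIndex fun k : Fin m => d k.succ) :
    prodVec x (Fin.cons a p) = x 0 a * prodVec (d := fun k : Fin m => d k.succ)
      (fun k => x k.succ) p := by
  simp [prodVec, Fin.prod_univ_succ]

theorem conjTranspose_headBlock {m : ℕ} {d : Fin (m + 1) → ℕ}
    {W : Matrix (MultiIndex d) (MultiIndex d) ℂ} (hW : W.IsHermitian) (i j : Fin (d 0)) :
    (headBlock W i j)ᴴ = headBlock W j i := by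
  ext p q
  exact hW.apply _ _

theorem headCompress_single_add_smul_single {m : ℕ} {d : Fin (m + 1) → ℕ}
    {W : Matrix (MultiIndex d) (MultiIndex d) ℂ} (hW : W.IsHermitian) (i j : Fin (d 0)) (z : ℂ) :
    headCompress W (Pi.single i 1 + z • Pi.single j 1) =
      compressTwo (headBlock W i i) (headBlock W j j) (headBlock W i j) z := by
  rw [compressTwo, conjTranspose_headBlock hW]
  simp only [headCompress, Pi.add_apply, Pi.smul_apply, star_add, add_mul, mul_add, add_smul,
    Finset.sum_add_distrib, smul_eq_mul, star_mul']
  simp [Pi.single_apply, Complex.normSq_eq_conj_mul_self, add_assoc]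
  abel

theorem IsBlockPositive.headCompress {m : ℕ} {d : Fin (m + 1) → ℕ}
    {W : Matrix (MultiIndex d) (MultiIndex d) ℂ} (hW : IsBlockPositive W) (x : Fin (d 0) → ℂ) :
    IsBlockPositive (headCompress W x) := by
  refine ⟨?_, fun y => ?_⟩
  · rw [Matrix.IsHermitian, _root_.headCompress]
    simp only [Matrix.conjTranspose_sum, Matrix.conjTranspose_smul, conjTranspose_headBlock hW.1]
    rw [Finset.sum_comm]
    simp [mul_comm]
  · convert hW.2 (Fin.cons x y) using 2
    simp only [dotProduct, Matrix.mulVec, sum_multiIndex_succ, Pi.star_apply, prodVec_cons,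
      _root_.headCompress, headBlock, Matrix.sum_apply, Matrix.smul_apply, Matrix.of_apply,
      Finset.mul_sum, Finset.sum_mul, Fin.cons_zero, Fin.cons_succ]
    conv_rhs => rw [Finset.sum_comm]
    refine Finset.sum_congr rfl fun p _ => ?_
    rw [Finset.sum_comm]
    refine Finset.sum_congr rfl fun a _ => ?_
    rw [Finset.sum_comm]
    refine Finset.sum_congr rfl fun b _ => Finset.sum_congr rfl fun q _ => ?_
    simp only [star_mul', smul_eq_mul]
    ring

theorem trace_eq_sum_headBlock {m : ℕ} {d : Fin (m + 1) → ℕ}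
    (W : Matrix (MultiIndex d) (MultiIndex d) ℂ) :
    W.trace.re = ∑ i, (headBlock W i i).trace.re := by
  simp [Matrix.trace, sum_multiIndex_succ, headBlock]

theorem frobenius_norm_sq_eq_sum_headBlock {m : ℕ} {d : Fin (m + 1) → ℕ}
    (W : Matrix (MultiIndex d) (MultiIndex d) ℂ) :
    ‖W‖ ^ 2 = ∑ i, ∑ j, ‖headBlock W i j‖ ^ 2 := by
  simp only [frobenius_norm_sq, sum_multiIndex_succ, headBlock, Matrix.of_apply]
  refine Finset.sum_congr rfl fun i _ => ?_
  rw [Finset.sum_comm]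

/-- With a single tensor factor every vector is a product vector. -/
theorem IsBlockPositive.posSemidef {d : Fin 1 → ℕ} {W : Matrix (MultiIndex d) (MultiIndex d) ℂ}
    (hW : IsBlockPositive W) : W.PosSemidef := by
  refine .of_dotProduct_mulVec_nonneg hW.1 fun v => ?_
  have hv : v = prodVec (d := d) (Fin.cons (fun a => v (Fin.cons a finZeroElim)) finZeroElim) := by
    ext i
    simp only [prodVec, Fin.prod_univ_one, Fin.cons_zero]
    congr 1
    ext k
    fin_cases k
    rfl
  refine Complex.nonneg_iff.2 ⟨?_, ?_⟩
  · rw [hv]; exact hW.2 _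
  · exact (hW.1.im_star_dotProduct_mulVec_self v).symm

theorem frobenius_norm_sq_le_of_headBlock_le {m : ℕ} {d : Fin (m + 1) → ℕ}
    {W : Matrix (MultiIndex d) (MultiIndex d) ℂ} {K : ℝ}
    (h : ∀ i j, ‖headBlock W i j‖ ^ 2 ≤
      K * ((headBlock W i i).trace.re * (headBlock W j j).trace.re)) :
    ‖W‖ ^ 2 ≤ K * W.trace.re ^ 2 := by
  rw [frobenius_norm_sq_eq_sum_headBlock, trace_eq_sum_headBlock, sq, Finset.sum_mul_sum,
    Finset.mul_sum]
  refine Finset.sum_le_sum fun i _ => ?_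
  rw [Finset.mul_sum]
  exact Finset.sum_le_sum fun j _ => h i j

theorem IsBlockPositive.trace_re_nonneg {m : ℕ} {d : Fin m → ℕ}
    {W : Matrix (MultiIndex d) (MultiIndex d) ℂ} (hW : IsBlockPositive W) : 0 ≤ W.trace.re := by
  rw [Matrix.trace, Complex.re_sum]
  refine Finset.sum_nonneg fun i _ => ?_
  have hpos := hW.2 (fun k => Pi.single (i k) 1)
  have : prodVec (d := d) (fun k => Pi.single (i k) 1) = Pi.single i 1 := by
    ext j
    by_cases hij : j = i
    · subst hij; simp [prodVec]
    · obtain ⟨k, hk⟩ := Function.ne_iff.1 hij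
      simp only [prodVec, Pi.single_apply, hij, if_false]
      exact Finset.prod_eq_zero (Finset.mem_univ k) (by simp [hk])
  rw [this] at hpos
  simpa using hpos

/-- The separable ball in dual form, for `n + 2` tensor factors. -/
theorem IsBlockPositive.frobenius_norm_le (n : ℕ) : ∀ {d : Fin (n + 2) → ℕ}
    {W : Matrix (MultiIndex d) (MultiIndex d) ℂ}, IsBlockPositive W →
      ‖W‖ ≤ √2 ^ n * W.trace.re := by
  induction n with
  | zero =>
    intro d W hW
    have h := frobenius_norm_sq_le_of_headBlock_le (K := 1) (W := W) fun i j => by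
      rw [one_mul]
      apply frobenius_norm_sq_le_of_compressTwo_posSemidef
      intro z
      rw [← headCompress_single_add_smul_single hW.1]
      exact (hW.headCompress _).posSemidef
    have := hW.trace_re_nonneg
    rw [one_mul] at h
    rw [pow_zero, one_mul]
    exact le_of_sq_le_sq h this
  | succ n ih =>
    intro d W hW
    have h := frobenius_norm_sq_le_of_headBlock_le (K := 2 * (√2 ^ n) ^ 2) (W := W) fun i j => by
      apply frobenius_norm_sq_le_of_compressTwo_norm_le
      intro z
      rw [← headCompress_single_add_smul_single hW.1]
      exact ih (hW.headCompress _)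
    have := hW.trace_re_nonneg
    refine le_of_sq_le_sq (h.trans_eq ?_) (by positivity)
    rw [pow_succ √2 n, mul_pow, mul_pow _ √2, Real.sq_sqrt zero_le_two]
    ring

/-! ### Separable states as a compact convex hull -/

/-- By Carathéodory's theorem, the convex hull of a compact set in finite dimension is a
continuous image of the product of a simplex with a power of that set. -/
theorem IsCompact.convexHull_of_finiteDimensional {E : Type*} [NormedAddCommGroup E]
    [NormedSpace ℝ E] [FiniteDimensional ℝ E] {s : Set E} (hs : IsCompact s) :
    IsCompact (convexHull ℝ s) := by
  rcases s.eq_empty_or_nonempty with rfl | ⟨x₀, hx₀⟩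
  · simp
  let N := Module.finrank ℝ E + 1
  have himage : convexHull ℝ s = (fun q : (Fin N → ℝ) × (Fin N → E) => ∑ i, q.1 i • q.2 i) ''
      (stdSimplex ℝ (Fin N) ×ˢ Set.univ.pi fun _ => s) := by
    ext x
    constructor
    · intro hx
      obtain ⟨ι, _, z, w, hz, hind, hw, hw1, hsum⟩ := eq_pos_convex_span_of_mem_convexHull hx
      have hcard : Fintype.card ι ≤ Fintype.card (Fin N) := by
        rw [Fintype.card_fin]
        exact hind.card_le_finrank_succ.trans (Nat.add_le_add_right (Submodule.finrank_le _) 1)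
      obtain ⟨f⟩ := Function.Embedding.nonempty_of_card_le hcard
      have hwf (i : ι) : Function.extend f w 0 (f i) = w i := f.injective.extend_apply _ _ _
      have hzf (i : ι) : Function.extend f z (fun _ => x₀) (f i) = z i :=
        f.injective.extend_apply _ _ _
      have hw0 (k : Fin N) (hk : k ∉ Set.range f) : Function.extend f w 0 k = 0 :=
        Function.extend_apply' _ _ _ hk
      refine ⟨(Function.extend f w 0, Function.extend f z fun _ => x₀), ⟨⟨fun k => ?_, ?_⟩,
        fun k _ => ?_⟩, ?_⟩
      · by_cases hk : k ∈ Set.range f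
        · obtain ⟨i, rfl⟩ := hk
          simpa only [hwf] using (hw i).le
        · exact (hw0 k hk).ge
      · rw [← hw1]
        exact (Fintype.sum_of_injective f f.injective w _ hw0 fun i => (hwf i).symm).symm
      · by_cases hk : k ∈ Set.range f
        · obtain ⟨i, rfl⟩ := hk
          simpa only [hzf] using hz (Set.mem_range_self i)
        · simpa only [Function.extend_apply' _ _ _ hk] using hx₀
      · rw [← hsum]
        refine (Fintype.sum_of_injective f f.injective (fun i => w i • z i) _ (fun k hk => ?_)
          fun i => ?_).symm
        · simp only [hw0 k hk, zero_smul]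
        · simp only [hwf, hzf]
    · rintro ⟨⟨w, z⟩, ⟨hw, hz⟩, rfl⟩
      exact mem_convexHull_of_exists_fintype w z hw.1 hw.2 (fun i => hz i (Set.mem_univ i)) rfl
  rw [himage]
  exact ((isCompact_stdSimplex ℝ (Fin N)).prod (isCompact_univ_pi fun _ => hs)).image (by fun_prop)

/-- The unit product vectors, as tuples of unit vectors. -/
def unitTuples {m : ℕ} (d : Fin m → ℕ) : Set ((k : Fin m) → EuclideanSpace ℂ (Fin (d k))) :=
  Set.univ.pi fun _ => Metric.sphere 0 1

/-- The entries of the pure product state given by a tuple of vectors. It is a function rather than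
a matrix so that the product topology applies. -/
def pureProduct {m : ℕ} {d : Fin m → ℕ} (x : (k : Fin m) → EuclideanSpace ℂ (Fin (d k))) :
    MultiIndex d → MultiIndex d → ℂ :=
  fun i j => prodVec (fun k => x k) i * star (prodVec (fun k => x k) j)

theorem isDensityMatrix_pureProj {ι : Type*} [Fintype ι] {ψ : EuclideanSpace ℂ ι}
    (hψ : ‖ψ‖ = 1) : IsDensityMatrix (pureProj ψ) := by
  refine ⟨Matrix.posSemidef_vecMulVec_self_star _, ?_⟩
  have h := EuclideanSpace.norm_sq_eq ψ
  rw [hψ] at h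
  rw [Matrix.trace]
  simp only [pureProj, Matrix.diag_apply, Matrix.vecMulVec_apply, Complex.star_def,
    Complex.mul_conj, Complex.normSq_eq_norm_sq]
  exact_mod_cast (by simpa using h.symm)

theorem tensorMatrix_pureProj {m : ℕ} {d : Fin m → ℕ}
    (x : (k : Fin m) → EuclideanSpace ℂ (Fin (d k))) :
    tensorMatrix (fun k => pureProj (x k)) = Matrix.of (pureProduct x) := by
  ext i j
  simp [tensorMatrix, pureProj, pureProduct, prodVec, Matrix.vecMulVec_apply,
    Finset.prod_mul_distrib]

theorem isSeparableState_of_mem_convexHull {m : ℕ} {d : Fin m → ℕ}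
    {ρ : Matrix (MultiIndex d) (MultiIndex d) ℂ}
    (h : Matrix.of.symm ρ ∈ convexHull ℝ (pureProduct '' unitTuples d)) : IsSeparableState ρ := by
  obtain ⟨ι, _, w, z, hw, hw1, hz, hsum⟩ := mem_convexHull_iff_exists_fintype.1 h
  choose x hx hxz using hz
  let e := Fintype.equivFin ι
  refine ⟨Fintype.card ι, fun s => w (e.symm s), fun s k => pureProj (x (e.symm s) k),
    fun s => hw _, ?_, fun s k => isDensityMatrix_pureProj ?_, ?_⟩
  · rw [e.symm.sum_comp]; exact hw1
  · simpa using hx (e.symm s) k (Set.mem_univ k)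
  · simp only [tensorMatrix_pureProj, hxz]
    rw [e.symm.sum_comp (fun i => (w i : ℂ) • Matrix.of (z i))]
    ext i j
    have := congrFun (congrFun hsum i) j
    simp only [Finset.sum_apply, Pi.smul_apply, Complex.real_smul] at this
    simpa [Matrix.sum_apply] using this.symm

theorem isCompact_pureProduct {m : ℕ} (d : Fin m → ℕ) :
    IsCompact (pureProduct '' unitTuples d) := by
  refine (isCompact_univ_pi fun _ => isCompact_sphere _ _).image ?_
  unfold pureProduct prodVec
  fun_prop

/-- Separation of a point from a compact convex set of matrices by the trace pairing. The set is
given in the space of functions `I → I → ℂ`, with its product topology. -/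
theorem exists_re_trace_mul_lt {I : Type*} [Fintype I] {K : Set (I → I → ℂ)} (hK : IsCompact K)
    (hconv : Convex ℝ K) {ρ : Matrix I I ℂ} (hρ : Matrix.of.symm ρ ∉ K) :
    ∃ (G : Matrix I I ℂ) (u : ℝ), (G * ρ).trace.re < u ∧
      ∀ X ∈ K, u ≤ (G * Matrix.of X).trace.re := by
  classical
  obtain ⟨f, u, h1, h2⟩ := RCLike.geometric_hahn_banach_point_closed (𝕜 := ℂ) hconv hK.isClosed hρ
  -- the matrix representing the functional `f` for the pairing `tr (G X)`
  refine ⟨Matrix.of fun j i => f (Pi.single i (Pi.single j 1)), u, ?_, fun X hX => ?_⟩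
  all_goals
    have hf (X : I → I → ℂ) : (Matrix.of (fun j i => f (Pi.single i (Pi.single j 1))) *
        Matrix.of X).trace = f X := by
      have : X = ∑ i, ∑ j, X i j • (Pi.single i (Pi.single j 1) : I → I → ℂ) := by
        ext i j
        simp [Finset.sum_apply, Pi.single_apply, ite_apply]
      conv_rhs => rw [this]
      simp only [map_sum, map_smul, Matrix.trace, Matrix.diag_apply, Matrix.mul_apply,
        Matrix.of_apply, smul_eq_mul]
      rw [Finset.sum_comm]
      simp only [mul_comm]
  · have := hf (Matrix.of.symm ρ)
    rw [Equiv.apply_symm_apply] at this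
    rw [this]
    exact h1
  · rw [hf]
    exact (h2 X hX).le

/-! ### Witnesses and the separable ball -/

/-- Nonnegativity of a quadratic form on unit product vectors extends to all product vectors by
scaling each factor. -/
theorem forall_prodVec_nonneg_of_unitTuples {m : ℕ} {d : Fin m → ℕ}
    {W : Matrix (MultiIndex d) (MultiIndex d) ℂ}
    (h : ∀ x ∈ unitTuples d,
      0 ≤ (star (prodVec fun k => (x k).ofLp) ⬝ᵥ W *ᵥ (prodVec fun k => (x k).ofLp)).re)
    (x : (k : Fin m) → Fin (d k) → ℂ) : 0 ≤ (star (prodVec x) ⬝ᵥ W *ᵥ prodVec x).re := by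
  by_cases h0 : ∃ k, x k = 0
  · obtain ⟨k, hk⟩ := h0
    have : prodVec x = 0 := by
      ext i
      exact Finset.prod_eq_zero (Finset.mem_univ k) (by simp [hk])
    simp [this]
  push Not at h0
  let r (k : Fin m) : ℝ := ‖WithLp.toLp 2 (x k)‖
  have hr (k : Fin m) : r k ≠ 0 := by simpa [r] using h0 k
  let y (k : Fin m) : EuclideanSpace ℂ (Fin (d k)) := ((r k)⁻¹ : ℂ) • WithLp.toLp 2 (x k)
  have hy : y ∈ unitTuples d := by
    intro k _
    have : ‖y k‖ = |r k|⁻¹ * r k := by simp [y, norm_smul, r]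
    rw [mem_sphere_zero_iff_norm, this, abs_of_nonneg (norm_nonneg _), inv_mul_cancel₀ (hr k)]
  have hxy : prodVec x = ((∏ k, r k : ℝ) : ℂ) • prodVec (d := d) fun k => (y k).ofLp := by
    ext i
    simp only [prodVec, Pi.smul_apply, smul_eq_mul, Complex.ofReal_prod,
      ← Finset.prod_mul_distrib]
    refine Finset.prod_congr rfl fun k _ => ?_
    have : (r k : ℂ) ≠ 0 := by exact_mod_cast hr k
    simp [y, this]
  have := h y hy
  rw [hxy]
  simp only [star_smul, Matrix.mulVec_smul, smul_dotProduct, dotProduct_smul, smul_eq_mul,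
    Complex.star_def, Complex.conj_ofReal, Complex.re_ofReal_mul]
  rw [← mul_assoc]
  exact mul_nonneg (mul_self_nonneg _) this

theorem trace_tensorMatrix {m : ℕ} {d : Fin m → ℕ}
    (A : (k : Fin m) → Matrix (Fin (d k)) (Fin (d k)) ℂ) :
    (tensorMatrix A).trace = ∏ k, (A k).trace := by
  simp [Matrix.trace, tensorMatrix, Fintype.prod_sum]

/-- An inseparable density matrix is detected by an element of the dual of the separable cone. -/
theorem exists_isBlockPositive_re_trace_mul_neg {m : ℕ} {d : Fin m → ℕ}
    {ρ : Matrix (MultiIndex d) (MultiIndex d) ℂ} (hρ : IsDensityMatrix ρ)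
    (hsep : ¬ IsSeparableState ρ) :
    ∃ W : Matrix (MultiIndex d) (MultiIndex d) ℂ, IsBlockPositive W ∧ (W * ρ).trace.re < 0 := by
  obtain ⟨G, u, hGρ, hG⟩ := exists_re_trace_mul_lt
    (isCompact_pureProduct d).convexHull_of_finiteDimensional (convex_convexHull ℝ _)
    (mt isSeparableState_of_mem_convexHull hsep)
  -- the Hermitian part of `G`, shifted so that the separating value `u` becomes `0`
  refine ⟨(2⁻¹ : ℂ) • (G + Gᴴ) - (u : ℂ) • 1, ⟨?_, ?_⟩, ?_⟩
  · rw [Matrix.IsHermitian]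
    simp [Matrix.conjTranspose_sub, Matrix.conjTranspose_smul, Matrix.conjTranspose_add, add_comm]
  · refine forall_prodVec_nonneg_of_unitTuples fun x hx => ?_
    have h1 := hG _ (subset_convexHull ℝ _ ⟨x, hx, rfl⟩)
    set v : MultiIndex d → ℂ := prodVec fun k => (x k).ofLp with hv
    have hpp : Matrix.of (pureProduct x) = Matrix.vecMulVec v (star v) := rfl
    have hvv : star v ⬝ᵥ v = 1 := by
      rw [dotProduct_comm, ← Matrix.trace_vecMulVec, ← hpp, ← tensorMatrix_pureProj,
        trace_tensorMatrix]
      refine Finset.prod_eq_one fun k _ => (isDensityMatrix_pureProj ?_).2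
      simpa using hx k (Set.mem_univ k)
    rw [hpp, Matrix.mul_vecMulVec, Matrix.trace_vecMulVec, dotProduct_comm] at h1
    have h2 : star v ⬝ᵥ Gᴴ *ᵥ v = star (star v ⬝ᵥ G *ᵥ v) := by
      rw [Matrix.star_dotProduct v, Matrix.star_mulVec, Matrix.conjTranspose_conjTranspose,
        ← Matrix.dotProduct_mulVec]
    simp only [Matrix.sub_mulVec, Matrix.smul_mulVec, Matrix.add_mulVec, dotProduct_sub,
      dotProduct_smul, dotProduct_add, h2, Matrix.one_mulVec, hvv]
    simp
    linarith
  · have h2 : (Gᴴ * ρ).trace = star (G * ρ).trace := by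
      rw [← Matrix.trace_conjTranspose, Matrix.conjTranspose_mul, hρ.1.1.eq, Matrix.trace_mul_comm]
    simp only [Matrix.sub_mul, Matrix.smul_mul, Matrix.add_mul, Matrix.one_mul, Matrix.trace_sub,
      Matrix.trace_smul, Matrix.trace_add, h2, hρ.2]
    simp
    linarith

/-- With at most one tensor factor every density matrix is a product state. -/
theorem isSeparableState_of_le_one {m : ℕ} (hm : m ≤ 1) {d : Fin m → ℕ}
    {ρ : Matrix (MultiIndex d) (MultiIndex d) ℂ} (hρ : IsDensityMatrix ρ) :
    IsSeparableState ρ := by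
  interval_cases m
  · refine ⟨1, fun _ => 1, fun _ => finZeroElim, by simp, by simp, fun _ k => k.elim0, ?_⟩
    ext i j
    have h := hρ.2
    rw [Matrix.trace, Fintype.sum_eq_single i fun k hk => (hk (Subsingleton.elim _ _)).elim] at h
    rw [Subsingleton.elim j i]
    simpa [tensorMatrix] using h
  · let e : Fin (d 0) ≃ MultiIndex d :=
      { toFun := fun a => Fin.cons a finZeroElim
        invFun := fun i => i 0
        left_inv := fun _ => rfl
        right_inv := fun i => by
          ext k
          fin_cases k
          rfl }
    refine ⟨1, fun _ => 1, fun _ => Fin.cons (ρ.submatrix e e) finZeroElim, by simp, by simp,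
      fun _ k => ?_, ?_⟩
    · rw [Subsingleton.elim k 0]
      refine ⟨hρ.1.submatrix e, ?_⟩
      rw [← hρ.2]
      exact e.sum_comp fun i => ρ i i
    · ext i j
      have hi (i : MultiIndex d) : e (i 0) = i := e.right_inv i
      simp [tensorMatrix, hi]

theorem two_rpow_half_sub_one (n : ℕ) : (2 : ℝ) ^ (((n + 2 : ℕ) : ℝ) / 2 - 1) = √2 ^ n := by
  rw [Real.sqrt_eq_rpow, ← Real.rpow_natCast, ← Real.rpow_mul zero_le_two]
  congr 1
  push_cast
  ring

theorem isSeparableState_of_norm_sub_maxMixed_le {m : ℕ} {d : Fin m → ℕ}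
    {ρ : Matrix (MultiIndex d) (MultiIndex d) ℂ} (hρ : IsDensityMatrix ρ)
    (hball : ‖ρ - maxMixed d‖ ≤ 1 / ((2 : ℝ) ^ ((m : ℝ) / 2 - 1) * (totalDim d : ℝ))) :
    IsSeparableState ρ := by
  rcases Nat.lt_or_ge m 2 with hm | hm
  · exact isSeparableState_of_le_one (Nat.le_of_lt_succ hm) hρ
  obtain ⟨n, rfl⟩ := Nat.exists_eq_add_of_le' hm
  by_contra hsep
  obtain ⟨W, hW, hneg⟩ := exists_isBlockPositive_re_trace_mul_neg hρ hsep
  rw [two_rpow_half_sub_one] at hball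
  have hWn := IsBlockPositive.frobenius_norm_le n hW
  have hs : (√2 : ℝ) ^ n ≠ 0 := by positivity
  have h1 : (W * ρ).trace.re =
      W.trace.re / totalDim d + (W * (ρ - maxMixed d)).trace.re := by
    rw [Matrix.mul_sub, Matrix.trace_sub, Complex.sub_re]
    have : (W * maxMixed d).trace.re = W.trace.re / totalDim d := by
      rw [maxMixed, Matrix.mul_smul, Matrix.mul_one, Matrix.trace_smul, smul_eq_mul,
        ← Complex.ofReal_natCast, ← Complex.ofReal_inv, Complex.re_ofReal_mul, div_eq_inv_mul]
    rw [this]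
    ring
  have h2 := abs_re_trace_mul_conjTranspose_le W (ρ - maxMixed d)ᴴ
  rw [Matrix.conjTranspose_conjTranspose, Matrix.frobenius_norm_conjTranspose] at h2
  have h3 : ‖W‖ * ‖ρ - maxMixed d‖ ≤ W.trace.re / totalDim d := by
    calc ‖W‖ * ‖ρ - maxMixed d‖
        ≤ (√2 ^ n * W.trace.re) * (1 / (√2 ^ n * totalDim d)) :=
          mul_le_mul hWn hball (norm_nonneg _) ((norm_nonneg _).trans hWn)
      _ = W.trace.re / totalDim d := by
          rw [mul_one_div, mul_div_mul_left _ _ hs]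
  linarith [neg_abs_le (W * (ρ - maxMixed d)).trace.re]

theorem card_multiIndex {m : ℕ} (d : Fin m → ℕ) : Fintype.card (MultiIndex d) = totalDim d := by
  simp [MultiIndex, totalDim]

theorem trace_maxMixed {m : ℕ} {d : Fin m → ℕ} (hd : totalDim d ≠ 0) :
    (maxMixed d).trace = 1 := by
  have : (totalDim d : ℂ) ≠ 0 := by exact_mod_cast hd
  rw [maxMixed, Matrix.trace_smul, Matrix.trace_one, card_multiIndex, smul_eq_mul,
    inv_mul_cancel₀ this]

theorem posSemidef_maxMixed {m : ℕ} (d : Fin m → ℕ) : (maxMixed d).PosSemidef := by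
  have h : (0 : ℂ) ≤ (totalDim d : ℂ)⁻¹ := by positivity
  exact Matrix.PosSemidef.one.smul h

theorem norm_sq_pureProj_sub_maxMixed {m : ℕ} {d : Fin m → ℕ} (hd : totalDim d ≠ 0)
    {ψ : EuclideanSpace ℂ (MultiIndex d)} (hψ : ‖ψ‖ = 1) :
    ‖pureProj ψ - maxMixed d‖ ^ 2 = 1 - (totalDim d : ℝ)⁻¹ := by
  have hπ := isDensityMatrix_pureProj hψ
  have hdd : (totalDim d : ℂ) ≠ 0 := by exact_mod_cast hd
  have hππ : pureProj ψ * pureProj ψ = pureProj ψ := by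
    have h := hπ.2
    rw [pureProj, Matrix.trace_vecMulVec, dotProduct_comm] at h
    rw [pureProj, Matrix.vecMulVec_mul_vecMulVec, h, one_smul]
  have htr : ((pureProj ψ - maxMixed d) * (pureProj ψ - maxMixed d)ᴴ).trace =
      ((1 - (totalDim d : ℝ)⁻¹ : ℝ) : ℂ) := by
    rw [(hπ.1.1.sub (posSemidef_maxMixed d).1).eq, Matrix.sub_mul, Matrix.mul_sub, hππ,
      Matrix.mul_sub]
    conv_lhs => simp only [maxMixed]
    simp only [Matrix.mul_smul, Matrix.smul_mul, Matrix.mul_one, Matrix.one_mul, Matrix.trace_sub,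
      Matrix.trace_smul, hπ.2, Matrix.trace_one, card_multiIndex, smul_eq_mul]
    push_cast
    field_simp
    ring
  rw [← re_trace_mul_conjTranspose_self, htr, Complex.ofReal_re]

theorem pseudopure_sub_maxMixed {m : ℕ} (d : Fin m → ℕ) (ε : ℝ)
    (ψ : EuclideanSpace ℂ (MultiIndex d)) :
    pseudopure d ε ψ - maxMixed d = (ε : ℂ) • (pureProj ψ - maxMixed d) := by
  rw [pseudopure]
  push_cast
  module

/-- The bound on `ε` forces `ε ≤ 1`, unless the total dimension is one, when `ε` is irrelevant. -/
theorem isDensityMatrix_pseudopure {m : ℕ} {d : Fin m → ℕ} (hd : totalDim d ≠ 0) {ε : ℝ}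
    (hε : 0 ≤ ε) {ψ : EuclideanSpace ℂ (MultiIndex d)} (hψ : ‖ψ‖ = 1)
    (h : ε * √((totalDim d : ℝ) * ((totalDim d : ℝ) - 1)) ≤ (2 : ℝ) ^ (-((m : ℝ) / 2 - 1))) :
    IsDensityMatrix (pseudopure d ε ψ) := by
  have hπ := isDensityMatrix_pureProj hψ
  refine ⟨?_, ?_⟩
  · by_cases h1 : totalDim d = 1
    · have hn := norm_sq_pureProj_sub_maxMixed hd hψ
      rw [h1, Nat.cast_one, inv_one, sub_self, sq_eq_zero_iff, norm_eq_zero] at hn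
      have := pseudopure_sub_maxMixed d ε ψ
      rw [hn, smul_zero, sub_eq_zero] at this
      rw [this]
      exact posSemidef_maxMixed d
    · have hm : 1 ≤ m := by
        by_contra hm
        obtain rfl : m = 0 := by omega
        exact h1 (by simp [totalDim])
      have h2 : (2 : ℝ) ≤ totalDim d := by exact_mod_cast (by omega : 2 ≤ totalDim d)
      have hε1 : ε ≤ 1 := by
        have hl : √2 ≤ √((totalDim d : ℝ) * ((totalDim d : ℝ) - 1)) :=
          Real.sqrt_le_sqrt (by nlinarith)
        have hr : (2 : ℝ) ^ (-((m : ℝ) / 2 - 1)) ≤ √2 := by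
          rw [Real.sqrt_eq_rpow]
          apply Real.rpow_le_rpow_of_exponent_le one_le_two
          have : (1 : ℝ) ≤ m := by exact_mod_cast hm
          linarith
        have hs : 0 < √(2 : ℝ) := by positivity
        have := (mul_le_mul_of_nonneg_left hl hε).trans (h.trans hr)
        nlinarith
      have e1 : (0 : ℂ) ≤ (ε : ℂ) := by exact_mod_cast hε
      have e2 : (0 : ℂ) ≤ ((1 - ε : ℝ) : ℂ) := by exact_mod_cast sub_nonneg.2 hε1
      exact (hπ.1.smul e1).add ((posSemidef_maxMixed d).smul e2)
  · rw [pseudopure, Matrix.trace_add, Matrix.trace_smul, Matrix.trace_smul, hπ.2,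
      trace_maxMixed hd]
    simp

theorem norm_pseudopure_sub_maxMixed_le {m : ℕ} {d : Fin m → ℕ} (hd : totalDim d ≠ 0) {ε : ℝ}
    (hε : 0 ≤ ε) {ψ : EuclideanSpace ℂ (MultiIndex d)} (hψ : ‖ψ‖ = 1)
    (h : ε * √((totalDim d : ℝ) * ((totalDim d : ℝ) - 1)) ≤ (2 : ℝ) ^ (-((m : ℝ) / 2 - 1))) :
    ‖pseudopure d ε ψ - maxMixed d‖ ≤
      1 / ((2 : ℝ) ^ ((m : ℝ) / 2 - 1) * (totalDim d : ℝ)) := by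
  have hD : (0 : ℝ) < totalDim d := by exact_mod_cast Nat.pos_of_ne_zero hd
  have hn : ‖pureProj ψ - maxMixed d‖ =
      √((totalDim d : ℝ) * ((totalDim d : ℝ) - 1)) / totalDim d := by
    rw [← Real.sqrt_sq (norm_nonneg (pureProj ψ - maxMixed d)),
      norm_sq_pureProj_sub_maxMixed hd hψ, eq_div_iff hD.ne']
    nth_rewrite 2 [← Real.sqrt_sq hD.le]
    rw [← Real.sqrt_mul' _ (sq_nonneg _)]
    congr 1
    field_simp
  rw [pseudopure_sub_maxMixed, norm_smul, Complex.norm_real, Real.norm_of_nonneg hε, hn,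
    ← mul_div_assoc, ← div_div, one_div, ← Real.rpow_neg zero_le_two]
  gcongr

theorem mainTheorem5 (m : ℕ) (d : Fin m → ℕ) :
    (∀ ρ : Matrix (MultiIndex d) (MultiIndex d) ℂ, IsDensityMatrix ρ →
        ‖ρ - maxMixed d‖ ≤ 1 / ((2 : ℝ) ^ ((m : ℝ) / 2 - 1) * (totalDim d : ℝ)) →
        IsSeparableState ρ) ∧
    (∀ (ψ : EuclideanSpace ℂ (MultiIndex d)) (ε : ℝ), ‖ψ‖ = 1 → 0 ≤ ε →
        ε * √((totalDim d : ℝ) * ((totalDim d : ℝ) - 1)) ≤ (2 : ℝ) ^ (-((m : ℝ) / 2 - 1)) →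
        IsSeparableState (pseudopure d ε ψ)) := by
  refine ⟨fun ρ hρ hball => isSeparableState_of_norm_sub_maxMixed_le hρ hball,
    fun ψ ε hψ hε h => ?_⟩
  have hd : totalDim d ≠ 0 := by
    intro h0
    have : IsEmpty (MultiIndex d) := Fintype.card_eq_zero_iff.1 ((card_multiIndex d).trans h0)
    simp [Subsingleton.elim ψ 0] at hψ
  exact isSeparableState_of_norm_sub_maxMixed_le (isDensityMatrix_pseudopure hd hε hψ h)
    (norm_pseudopure_sub_maxMixed_le hd hε hψ h)
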